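/- Let $k\ge 3$ and $n\ge 6k$ be integers, and let $[n]=\{1,\dots,n\}$. For a family $\mathcal F$ of $k$-element subsets of $[n]$, the degree of $x\in[n]$ is the number of members of $\mathcal F$ containing $x$, and $d_i(\mathcal F)$ denotes the $i$-th largest degree of $\mathcal F$, i.e. $d_1(\mathcal F)\ge d_2(\mathcal F)\ge\dots\ge d_n(\mathcal F)$ are the degrees of the elements of $[n]$, listed with multiplicity. If $\mathcal F$ is intersecting, i.e. $F\cap F'\neq\emptyset$ for all $F,F'\in\mathcal F$, then $$d_4(\mathcal F)\le\binom{n-2}{k-2}+\binom{n-4}{k-3}.$$ Moreover, the bound is attained: the family $$\mathcal H_3=\left\{H\in\tbinom{[n]}{k}: 1\in H,\ H\cap\{2,3,4\}\ne\emptyset\right\}\cup\left\{H\in\tbinom{[n]}{k}:\{2,3,4\}\subset H\right\}$$ is intersecting and satisfies $d_4(\mathcal H_3)=\binom{n-2}{k-2}+\binom{n-4}{k-3}$. -/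

import Mathlib

/-! The ground set `[n] = {1, …, n}` is modelled by `Fin n`: the element `j` of `[n]` is the element of
`Fin n` with value `j - 1`. A family of subsets of `[n]` is a `Finset (Finset (Fin n))`. -/

/-- The degree of `x` in the family `F`: the number of members of `F` that contain `x`. -/
def vertexDegree {n : ℕ} (F : Finset (Finset (Fin n))) (x : Fin n) : ℕ :=
  (F.filter (fun A => x ∈ A)).card

/-- A permutation `x₁, …, xₙ` of the ground set that lists the vertices in the order of
non-increasing degree. -/
def degreeOrder {n : ℕ} (F : Finset (Finset (Fin n))) : Equiv.Perm (Fin n) :=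
  Tuple.sort (fun x => OrderDual.toDual (vertexDegree F x))

/-- `d_i(F)`, the `i`-th largest degree of `F` (with multiplicity), for `1 ≤ i ≤ n`: the degree of
the `i`-th vertex in an order of non-increasing degree. The value for other `i` is irrelevant. -/
def largestDegree {n : ℕ} (F : Finset (Finset (Fin n))) (i : ℕ) : ℕ :=
  if h : 1 ≤ i ∧ i ≤ n then vertexDegree F (degreeOrder F ⟨i - 1, by omega⟩) else 0

/-- `degreeOrder F` does list the vertices in the order of non-increasing degree. -/
theorem antitone_degreeOrder {n : ℕ} (F : Finset (Finset (Fin n))) :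
    Antitone (fun j => vertexDegree F (degreeOrder F j)) :=
  fun _ _ hab => Tuple.monotone_sort (fun x => OrderDual.toDual (vertexDegree F x)) hab

/-- `d_i(F)` does not depend on the choice of the order of non-increasing degree. -/
theorem largestDegree_eq {n : ℕ} (F : Finset (Finset (Fin n))) (x : Equiv.Perm (Fin n))
    (hx : Antitone (fun j => vertexDegree F (x j))) (i : ℕ) (h1 : 1 ≤ i) (h2 : i ≤ n) :
    largestDegree F i = vertexDegree F (x ⟨i - 1, by omega⟩) := by
  have hm : Monotone ((fun y => OrderDual.toDual (vertexDegree F y)) ∘ x) := fun _ _ hab => hx hab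
  have h := (Tuple.comp_sort_eq_comp_iff_monotone
    (f := fun y => OrderDual.toDual (vertexDegree F y)) (σ := x)).2 hm
  have h' := congrFun h ⟨i - 1, by omega⟩
  rw [largestDegree, dif_pos ⟨h1, h2⟩]
  exact (OrderDual.toDual_inj.1 h').symm

/-- The family `H_ℓ(n, k)`: the `k`-subsets `H` of `[n]` such that `1 ∈ H` and `H` meets
`[2, ℓ + 1]`, or `H` contains `[2, ℓ + 1]`. (In `Fin n`, the element `1` has value `0`, and the
elements of `[2, ℓ + 1]` are those with value in `[1, ℓ]`.) -/
def familyH (n k l : ℕ) : Finset (Finset (Fin n)) :=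
  (Finset.powersetCard k (Finset.univ : Finset (Fin n))).filter (fun H =>
    ((∃ x ∈ H, x.val = 0) ∧ (∃ x ∈ H, 1 ≤ x.val ∧ x.val ≤ l)) ∨
      (∀ x : Fin n, 1 ≤ x.val ∧ x.val ≤ l → x ∈ H))

/-! Let the four vertices of largest degree have indices 0, 1, 2, 3. For each set `S` of indices,
let `F_S` be the members of `F` meeting these vertices exactly in `S`, with the four vertices
removed. It is a family of `(k - |S|)`-sets on `m = n - 4` points, and `F_S`, `F_T` are
cross-intersecting when `S` and `T` are disjoint. The four degrees are sums of the sizes `|F_S|`, so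
it suffices that these sums cannot all exceed the bound.

If `𝒜` (`a`-sets) and `ℬ` (`b`-sets) are cross-intersecting, then `ℬ` avoids the `b`-shadow of the
complements of `𝒜`. Kruskal–Katona then gives a linear trade-off between the sizes as long as `𝒜` is
no larger than a full star (`cross_intersecting_of_card_le`), and a fixed loss for `ℬ` once `|𝒜|`
reaches `C(m-j, a-j)` (`cross_intersecting_of_le_card`).

Call a trace small if it is no larger than a star. Of two complementary pairs at least one is small.
Hence either all pairs avoiding some index `c` are small, or all pairs containing some `c` are small
(`exists_forall_pair`). A singleton `{c}` that is not small forces the first situation. In that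
situation a weighted sum of the trade-offs bounds the total degree of the three other vertices
(`star_arith`). In the second, the fixed losses make the four degree conditions incompatible
(`triangle_arith`). -/

/-! ### Shadows and cross-intersecting families -/

open Finset in
theorem card_filter_subset_disjoint {α : Type*} [DecidableEq α] {X S R : Finset α} {r : ℕ}
    (hS : S ⊆ X) (hR : R ⊆ X) (hSR : Disjoint S R) (hr : S.card ≤ r) :
    ((powersetCard r X).filter (fun A => S ⊆ A ∧ Disjoint A R)).card
      = (X.card - S.card - R.card).choose (r - S.card) := by
  have hc : ((X \ S) \ R).card = X.card - S.card - R.card := by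
    rw [card_sdiff_of_subset, card_sdiff_of_subset hS]
    intro a ha
    exact mem_sdiff.2 ⟨hR ha, fun h => disjoint_left.1 hSR h ha⟩
  rw [← hc, ← card_powersetCard]
  refine card_bij' (fun A _ => A \ S) (fun B _ => B ∪ S) ?_ ?_ ?_ ?_
  · intro A hA
    rw [mem_filter, mem_powersetCard] at hA
    obtain ⟨⟨h1, h2⟩, h3, h4⟩ := hA
    rw [mem_powersetCard]
    refine ⟨fun a ha => ?_, by rw [card_sdiff_of_subset h3, h2]⟩
    rw [mem_sdiff] at ha
    simp only [mem_sdiff]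
    exact ⟨⟨h1 ha.1, ha.2⟩, disjoint_left.1 h4 ha.1⟩
  · intro B hB
    rw [mem_powersetCard] at hB
    have hBS : Disjoint B S := disjoint_left.2 fun a ha hs => by
      have := hB.1 ha
      simp only [mem_sdiff] at this
      exact this.1.2 hs
    rw [mem_filter, mem_powersetCard, card_union_of_disjoint hBS, hB.2]
    refine ⟨⟨union_subset (hB.1.trans (sdiff_subset.trans sdiff_subset)) hS, by omega⟩,
      subset_union_right, disjoint_union_left.2 ⟨?_, hSR⟩⟩
    exact disjoint_left.2 fun a ha => (mem_sdiff.1 (hB.1 ha)).2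
  · intro A hA
    exact sdiff_union_of_subset (mem_filter.1 hA).2.1
  · intro B hB
    rw [mem_powersetCard] at hB
    refine union_sdiff_cancel_right (disjoint_left.2 fun a ha => ?_)
    have := hB.1 ha
    simp only [mem_sdiff] at this
    exact this.1.2

open Finset FinsetFamily in
/-- Iterated local LYM inequality on a ground set `X`. -/
theorem card_mul_choose_le_card_shadow_iterate_mul_choose {α : Type*} [DecidableEq α]
    {X : Finset α} {𝒜 : Finset (Finset α)} {r b : ℕ} (h𝒜 : 𝒜 ⊆ powersetCard r X)
    (hb : b ≤ r) :
    𝒜.card * X.card.choose b ≤ (∂^[r - b] 𝒜).card * X.card.choose r := by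
  -- Double counting of the pairs `B ⊆ A` with `A` in `𝒜` and `B` in its shadow.
  have key : 𝒜.card * r.choose b ≤ (∂^[r - b] 𝒜).card * (X.card - b).choose (r - b) := by
    refine card_mul_le_card_mul (fun A B => B ⊆ A) ?_ ?_
    · intro A hA
      have hAr := (mem_powersetCard.1 (h𝒜 hA)).2
      rw [← hAr, ← card_powersetCard]
      refine card_le_card fun B hB => ?_
      rw [mem_powersetCard] at hB
      rw [mem_bipartiteAbove, mem_shadow_iterate_iff_exists_mem_card_add]
      exact ⟨⟨A, hA, hB.1, by omega⟩, hB.1⟩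
    · intro B hB
      obtain ⟨A, hA, hBA, hc⟩ := mem_shadow_iterate_iff_exists_mem_card_add.1 hB
      have hA' := mem_powersetCard.1 (h𝒜 hA)
      have hBb : B.card = b := by omega
      have := card_filter_subset_disjoint (r := r) (hBA.trans hA'.1) (empty_subset X)
        (disjoint_empty_right B) (by omega)
      rw [hBb, card_empty, Nat.sub_zero] at this
      rw [← this]
      refine card_le_card fun A hA => ?_
      rw [mem_bipartiteBelow] at hA
      exact mem_filter.2 ⟨h𝒜 hA.1, hA.2, disjoint_empty_right A⟩
  have hpos : 0 < r.choose b := Nat.choose_pos hb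
  refine Nat.le_of_mul_le_mul_right ?_ hpos
  calc 𝒜.card * X.card.choose b * r.choose b = 𝒜.card * r.choose b * X.card.choose b := by ring
    _ ≤ (∂^[r - b] 𝒜).card * (X.card - b).choose (r - b) * X.card.choose b :=
      Nat.mul_le_mul_right _ key
    _ = (∂^[r - b] 𝒜).card * (X.card.choose b * (X.card - b).choose (r - b)) := by ring
    _ = (∂^[r - b] 𝒜).card * X.card.choose r * r.choose b := by
      rw [← Nat.choose_mul hb]; ring

open Finset Finset.Colex in
/-- Among the `r`-subsets of the first `M` elements there are initial segments of the colex order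
of all sizes. -/
theorem exists_isInitSeg_card_eq {n M r c : ℕ} (hM : M ≤ n) (hc : c ≤ M.choose r) :
    ∃ X : Finset (Fin n), X.card = M ∧ ∃ 𝒞 ⊆ powersetCard r X, IsInitSeg 𝒞 r ∧ 𝒞.card = c := by
  have hX : (univ.filter (fun i : Fin n => i.val < M)).card = M := by
    rw [Fin.card_filter_val_lt, min_eq_right hM]
  refine ⟨_, hX, ?_⟩
  set X := univ.filter (fun i : Fin n => i.val < M)
  induction c with
  | zero => exact ⟨∅, empty_subset _, isInitSeg_empty, card_empty⟩
  | succ c ih =>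
    obtain ⟨𝒞, h𝒞, hi, hcard⟩ := ih (by omega)
    have hne : (powersetCard r X \ 𝒞).Nonempty := by
      rw [← card_pos, card_sdiff_of_subset h𝒞, card_powersetCard, hX]
      omega
    -- Adding the colex-least missing set preserves initial segments: a colex-smaller set of the
    -- same size stays inside the first `M` elements, so it cannot be missing too.
    obtain ⟨s, hs, hmin⟩ := exists_min_image _ toColex hne
    rw [mem_sdiff, mem_powersetCard] at hs
    refine ⟨insert s 𝒞, insert_subset (mem_powersetCard.2 hs.1) h𝒞, ⟨?_, ?_⟩, ?_⟩
    · intro t ht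
      rcases mem_insert.1 (mem_coe.1 ht) with rfl | ht
      exacts [hs.1.2, hi.1 ht]
    · rintro u t hu ⟨htu, htr⟩
      rcases mem_insert.1 hu with rfl | hu
      · by_contra ht
        refine (hmin t (mem_sdiff.2 ⟨mem_powersetCard.2 ⟨fun a ha => ?_, htr⟩,
          fun h => ht (mem_insert_of_mem h)⟩)).not_gt htu
        have hlt : toColex (image Fin.val t) < toColex (image Fin.val u) := by
          rwa [toColex_image_lt_toColex_image Fin.val_strictMono]
        have := forall_lt_mono (a := M) hlt.le (by
          intro b hb
          obtain ⟨a, ha, rfl⟩ := mem_image.1 hb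
          exact (mem_filter.1 (hs.1.1 ha)).2) a (mem_image_of_mem _ ha)
        exact mem_filter.2 ⟨mem_univ _, this⟩
      · exact mem_insert_of_mem (hi.2 hu ⟨htu, htr⟩)
    · rw [card_insert_of_notMem hs.2, hcard]

open Finset FinsetFamily in
/-- Among families of at most `M.choose r` sets of size `r`, shadows are relatively at least as
large as those of the family of all `r`-subsets of an `M`-element set. -/
theorem card_mul_choose_le_card_shadow_mul_of_card_le {n M r b : ℕ}
    {𝒜 : Finset (Finset (Fin n))} (h𝒜 : (𝒜 : Set (Finset (Fin n))).Sized r) (hM : M ≤ n)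
    (hb : b ≤ r) (hr : r ≤ M) (hcard : 𝒜.card ≤ M.choose r) :
    𝒜.card * M.choose b ≤ (∂^[r - b] 𝒜).card * M.choose r := by
  -- By Kruskal–Katona, an initial segment of the same size has the least shadow. It lives on `M`
  -- points, where local LYM applies.
  obtain ⟨X, rfl, 𝒞, h𝒞, hi, hc⟩ := exists_isInitSeg_card_eq hM hcard
  rw [← hc]
  exact (card_mul_choose_le_card_shadow_iterate_mul_choose h𝒞 hb).trans
    (Nat.mul_le_mul_right _ (iterated_kk h𝒜 hc.le hi))

open Finset FinsetFamily in
/-- Sets of the family `ℬ` are not in the shadow of the complements of the sets of `𝒜`, if `𝒜` and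
`ℬ` are cross-intersecting. -/
theorem card_add_card_shadow_compl_le {n a b : ℕ} {U : Finset (Fin n)}
    {𝒜 ℬ : Finset (Finset (Fin n))} (h𝒜 : 𝒜 ⊆ powersetCard a U) (hℬ : ℬ ⊆ powersetCard b U)
    (h : ∀ A ∈ 𝒜, ∀ B ∈ ℬ, ¬Disjoint A B) :
    ∃ 𝒟 : Finset (Finset (Fin n)), (𝒟 : Set (Finset (Fin n))).Sized (U.card - a) ∧
      𝒟.card = 𝒜.card ∧
      (b ≤ U.card - a → ℬ.card + (∂^[U.card - a - b] 𝒟).card ≤ U.card.choose b) := by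
  refine ⟨𝒜.image (U \ ·), ?_, ?_, fun hb => ?_⟩
  · intro D hD
    obtain ⟨A, hA, rfl⟩ := mem_image.1 (mem_coe.1 hD)
    have hA := mem_powersetCard.1 (h𝒜 hA)
    rw [card_sdiff_of_subset hA.1, hA.2]
  · refine card_image_of_injOn fun A hA B hB hAB => ?_
    have hA := (mem_powersetCard.1 (h𝒜 hA)).1
    have hB := (mem_powersetCard.1 (h𝒜 hB)).1
    rw [← Finset.sdiff_sdiff_eq_self hA, ← Finset.sdiff_sdiff_eq_self hB]
    exact congrArg (U \ ·) hAB
  · rw [← card_powersetCard, ← card_union_of_disjoint]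
    · refine card_le_card (union_subset hℬ fun B hB => ?_)
      obtain ⟨D, hD, hBD, hc⟩ := mem_shadow_iterate_iff_exists_mem_card_add.1 hB
      obtain ⟨A, hA, rfl⟩ := mem_image.1 hD
      have hA := mem_powersetCard.1 (h𝒜 hA)
      rw [card_sdiff_of_subset hA.1, hA.2] at hc
      exact mem_powersetCard.2 ⟨hBD.trans sdiff_subset, by omega⟩
    · refine disjoint_left.2 fun B hB hB' => ?_
      obtain ⟨D, hD, hBD, -⟩ := mem_shadow_iterate_iff_exists_mem_card_add.1 hB'
      obtain ⟨A, hA, rfl⟩ := mem_image.1 hD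
      exact h A hA B hB (disjoint_left.2 fun x hxA hxB => (mem_sdiff.1 (hBD hxB)).2 hxA)

-- The complements of `𝒜` number at most `C(m-1, m-a)`, so their `b`-shadow is relatively at least
-- that of all `(m-a)`-subsets of an `(m-1)`-set. The result interpolates linearly between `𝒜` empty
-- and `𝒜` a full star.
open Finset in
theorem cross_intersecting_of_card_le {n a b m : ℕ} {U : Finset (Fin n)} (hU : U.card = m)
    {𝒜 ℬ : Finset (Finset (Fin n))} (h𝒜 : 𝒜 ⊆ powersetCard a U) (hℬ : ℬ ⊆ powersetCard b U)
    (h : ∀ A ∈ 𝒜, ∀ B ∈ ℬ, ¬Disjoint A B) (ha : 1 ≤ a) (hab : a + b ≤ m)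
    (hcard : 𝒜.card ≤ (m - 1).choose (a - 1)) :
    ℬ.card * (m - 1).choose (a - 1) + 𝒜.card * (m - 1).choose b
      ≤ m.choose b * (m - 1).choose (a - 1) := by
  subst hU
  obtain ⟨𝒟, hs, hc, hle⟩ := card_add_card_shadow_compl_le h𝒜 hℬ h
  have hle := hle (by omega)
  have hn : U.card ≤ n := by simpa using card_le_univ U
  have hch : (U.card - 1).choose (a - 1) = (U.card - 1).choose (U.card - a) :=
    (Nat.choose_symm_of_eq_add (by omega))
  rw [hch] at hcard ⊢
  have := card_mul_choose_le_card_shadow_mul_of_card_le hs (M := U.card - 1) (b := b) (by omega)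
    (by omega) (by omega) (hc ▸ hcard)
  rw [hc] at this
  refine (Nat.add_le_add_left this _).trans ?_
  rw [← add_mul]
  exact Nat.mul_le_mul_right _ hle

-- Since `C(m-j, a-j) = C(m-j, m-a)`, the Lovász form of Kruskal–Katona gives the complements of `𝒜`
-- at least `C(m-j, b)` sets in their `b`-shadow, all missing from `ℬ`.
open Finset in
theorem cross_intersecting_of_le_card {n a b m j : ℕ} {U : Finset (Fin n)} (hU : U.card = m)
    {𝒜 ℬ : Finset (Finset (Fin n))} (h𝒜 : 𝒜 ⊆ powersetCard a U) (hℬ : ℬ ⊆ powersetCard b U)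
    (h : ∀ A ∈ 𝒜, ∀ B ∈ ℬ, ¬Disjoint A B) (ha : j ≤ a) (hab : a + b ≤ m)
    (hcard : (m - j).choose (a - j) ≤ 𝒜.card) :
    ℬ.card + (m - j).choose b ≤ m.choose b := by
  subst hU
  obtain ⟨𝒟, hs, hc, hle⟩ := card_add_card_shadow_compl_le h𝒜 hℬ h
  have hle := hle (by omega)
  have hn : U.card ≤ n := by simpa using card_le_univ U
  have hch : (U.card - j).choose (a - j) = (U.card - j).choose (U.card - a) :=
    (Nat.choose_symm_of_eq_add (by omega))
  rw [hch] at hcard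
  have := kruskal_katona_lovasz_form (i := U.card - a - b) (k := U.card - j) (by omega)
    (by omega) (by omega) hs (hc ▸ hcard)
  rw [Nat.sub_sub_self (by omega)] at this
  omega


/-! ### Traces on distinguished vertices -/

/-- The sets of `F` that contain exactly those of the vertices `x i` with `i ∈ S`, with these
vertices removed. -/
def traceFamily {n : ℕ} {ι : Type*} [Fintype ι] [DecidableEq ι] (F : Finset (Finset (Fin n)))
    (x : ι → Fin n) (S : Finset ι) : Finset (Finset (Fin n)) :=
  (F.filter (fun A => ∀ i, x i ∈ A ↔ i ∈ S)).image (· \ Finset.univ.image x)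

section Trace

open Finset

variable {n : ℕ} {ι : Type*} [Fintype ι] {F : Finset (Finset (Fin n))} {x : ι → Fin n}

theorem inter_image_eq_of_trace {A : Finset (Fin n)} {S : Finset ι}
    (hA : ∀ i, x i ∈ A ↔ i ∈ S) : A ∩ univ.image x = S.image x := by
  ext a
  simp only [mem_inter, mem_image, mem_univ, true_and]
  constructor
  · rintro ⟨ha, i, rfl⟩
    exact ⟨i, (hA i).1 ha, rfl⟩
  · rintro ⟨i, hi, rfl⟩
    exact ⟨(hA i).2 hi, i, rfl⟩

variable [DecidableEq ι]

theorem card_traceFamily (S : Finset ι) :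
    (traceFamily F x S).card = (F.filter (fun A => ∀ i, x i ∈ A ↔ i ∈ S)).card := by
  refine card_image_of_injOn fun A hA B hB hAB => ?_
  have hA := inter_image_eq_of_trace (mem_filter.1 hA).2
  have hB := inter_image_eq_of_trace (mem_filter.1 hB).2
  rw [← sdiff_union_inter A (univ.image x), ← sdiff_union_inter B (univ.image x), hA, hB]
  exact congrArg (· ∪ S.image x) hAB

theorem traceFamily_subset_powersetCard {k : ℕ} (hF : (F : Set (Finset (Fin n))).Sized k)
    (hx : Function.Injective x) (S : Finset ι) :
    traceFamily F x S ⊆ powersetCard (k - S.card) (univ \ univ.image x) := by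
  intro B hB
  obtain ⟨A, hA, rfl⟩ := mem_image.1 hB
  obtain ⟨hA, hS⟩ := mem_filter.1 hA
  rw [mem_powersetCard]
  refine ⟨sdiff_subset_sdiff (subset_univ _) subset_rfl, ?_⟩
  have := card_sdiff_add_card_inter A (univ.image x)
  rw [inter_image_eq_of_trace hS, card_image_of_injective _ hx, hF hA] at this
  omega

theorem card_traceFamily_le {k : ℕ} (hF : (F : Set (Finset (Fin n))).Sized k)
    (hx : Function.Injective x) (S : Finset ι) :
    (traceFamily F x S).card ≤ (n - Fintype.card ι).choose (k - S.card) := by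
  refine (card_le_card (traceFamily_subset_powersetCard hF hx S)).trans ?_
  rw [card_powersetCard, card_sdiff_of_subset (subset_univ _), card_image_of_injective _ hx,
    card_univ, card_univ, Fintype.card_fin]

theorem traceFamily_eq_empty {k : ℕ} (hF : (F : Set (Finset (Fin n))).Sized k)
    (hx : Function.Injective x) {S : Finset ι} (hS : k < S.card) : traceFamily F x S = ∅ := by
  rw [traceFamily, image_eq_empty, filter_eq_empty_iff]
  intro A hA h
  have := card_le_card (inter_subset_left (s₁ := A) (s₂ := univ.image x))
  rw [inter_image_eq_of_trace h, card_image_of_injective _ hx, hF hA] at this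
  omega

/-- The original sets meet, but not in a distinguished vertex, as `S` and `T` are disjoint. -/
theorem traceFamily_cross_intersecting (hF : (F : Set (Finset (Fin n))).Intersecting)
    {S T : Finset ι} (hST : Disjoint S T) :
    ∀ A ∈ traceFamily F x S, ∀ B ∈ traceFamily F x T, ¬Disjoint A B := by
  intro A hA B hB h
  obtain ⟨A', hA', rfl⟩ := mem_image.1 hA
  obtain ⟨B', hB', rfl⟩ := mem_image.1 hB
  obtain ⟨hA, hS⟩ := mem_filter.1 hA'
  obtain ⟨hB, hT⟩ := mem_filter.1 hB'
  refine hF hA hB (disjoint_left.2 fun a haA haB => ?_)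
  by_cases ha : a ∈ univ.image x
  · obtain ⟨i, -, rfl⟩ := mem_image.1 ha
    exact disjoint_left.1 hST ((hS i).1 haA) ((hT i).1 haB)
  · exact disjoint_left.1 h (mem_sdiff.2 ⟨haA, ha⟩) (mem_sdiff.2 ⟨haB, ha⟩)

theorem vertexDegree_eq_sum_card_traceFamily (i : ι) :
    vertexDegree F (x i) = ∑ S ∈ univ.filter (i ∈ ·), (traceFamily F x S).card := by
  rw [vertexDegree, card_eq_sum_card_fiberwise (f := fun A => univ.filter (x · ∈ A))
    (t := univ.filter (i ∈ ·))]
  · refine sum_congr rfl fun S hS => ?_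
    rw [card_traceFamily, filter_filter]
    congr 1
    refine filter_congr fun A _ => ⟨fun h j => ?_, fun h => ⟨(h i).2 (mem_filter.1 hS).2, ?_⟩⟩
    · rw [← h.2]
      simp
    · ext j
      simp [h j]
  · intro A hA
    exact mem_coe.2 (mem_filter.2 ⟨mem_univ _, mem_filter.2 ⟨mem_univ _, (mem_filter.1 hA).2⟩⟩)

/-- Allows the special index `c` of the case distinction to be moved to 0. -/
theorem traceFamily_comp (σ : Equiv.Perm ι) (S : Finset ι) :
    traceFamily F (x ∘ σ) S = traceFamily F x (S.map σ.toEmbedding) := by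
  have him : univ.image (x ∘ σ) = univ.image x := by
    rw [← image_image, image_univ_equiv]
  have hfil : ∀ A : Finset (Fin n), (∀ i, (x ∘ σ) i ∈ A ↔ i ∈ S) ↔
      ∀ i, x i ∈ A ↔ i ∈ S.map σ.toEmbedding := by
    intro A
    rw [σ.forall_congr_left]
    simp
  simp only [traceFamily, him, hfil]

end Trace

theorem vertexDegree_eq_of_four {n : ℕ} (F : Finset (Finset (Fin n))) (x : Fin 4 → Fin n) :
    let f := fun S => (traceFamily F x S).card
    vertexDegree F (x 0) = f {0} + f {0, 1} + f {0, 2} + f {0, 3} + f {0, 1, 2} + f {0, 1, 3}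
      + f {0, 2, 3} + f {0, 1, 2, 3} ∧
    vertexDegree F (x 1) = f {1} + f {0, 1} + f {1, 2} + f {1, 3} + f {0, 1, 2} + f {0, 1, 3}
      + f {1, 2, 3} + f {0, 1, 2, 3} ∧
    vertexDegree F (x 2) = f {2} + f {0, 2} + f {1, 2} + f {2, 3} + f {0, 1, 2} + f {0, 2, 3}
      + f {1, 2, 3} + f {0, 1, 2, 3} ∧
    vertexDegree F (x 3) = f {3} + f {0, 3} + f {1, 3} + f {2, 3} + f {0, 1, 3} + f {0, 2, 3}
      + f {1, 2, 3} + f {0, 1, 2, 3} := by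
  intro f
  have h0 : Finset.univ.filter (fun S : Finset (Fin 4) => 0 ∈ S) = {{0}, {0, 1}, {0, 2}, {0, 3},
    {0, 1, 2}, {0, 1, 3}, {0, 2, 3}, {0, 1, 2, 3}} := by decide
  have h1 : Finset.univ.filter (fun S : Finset (Fin 4) => 1 ∈ S) = {{1}, {0, 1}, {1, 2}, {1, 3},
    {0, 1, 2}, {0, 1, 3}, {1, 2, 3}, {0, 1, 2, 3}} := by decide
  have h2 : Finset.univ.filter (fun S : Finset (Fin 4) => 2 ∈ S) = {{2}, {0, 2}, {1, 2}, {2, 3},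
    {0, 1, 2}, {0, 2, 3}, {1, 2, 3}, {0, 1, 2, 3}} := by decide
  have h3 : Finset.univ.filter (fun S : Finset (Fin 4) => 3 ∈ S) = {{3}, {0, 3}, {1, 3}, {2, 3},
    {0, 1, 3}, {0, 2, 3}, {1, 2, 3}, {0, 1, 2, 3}} := by decide
  refine ⟨?_, ?_, ?_, ?_⟩
  · rw [vertexDegree_eq_sum_card_traceFamily, h0]
    repeat rw [Finset.sum_insert (by decide)]
    rw [Finset.sum_singleton]
    ring
  · rw [vertexDegree_eq_sum_card_traceFamily, h1]
    repeat rw [Finset.sum_insert (by decide)]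
    rw [Finset.sum_singleton]
    ring
  · rw [vertexDegree_eq_sum_card_traceFamily, h2]
    repeat rw [Finset.sum_insert (by decide)]
    rw [Finset.sum_singleton]
    ring
  · rw [vertexDegree_eq_sum_card_traceFamily, h3]
    repeat rw [Finset.sum_insert (by decide)]
    rw [Finset.sum_singleton]
    ring


/-! ### Arithmetic of the two cases -/

/-- The arithmetic of the case that most members of the family contain the vertex `0`. -/
theorem star_arith {N₂ N₃ P Q f₁ f₂ f₃ f₀₁ f₀₂ f₀₃ f₁₂ f₁₃ f₂₃ f₀₁₂ f₀₁₃ f₀₂₃ f₁₂₃ e : ℕ}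
    (hP : 0 < P) (hPQ : 2 * Q ≤ P)
    (a₁ : f₀₁ + f₃ ≤ N₂) (a₂ : f₀₂ + f₁ ≤ N₂) (a₃ : f₀₃ + f₂ ≤ N₂)
    (b₁ : f₀₁ * Q + f₂₃ * P ≤ N₂ * Q) (b₂ : f₀₂ * Q + f₁₃ * P ≤ N₂ * Q)
    (b₃ : f₀₃ * Q + f₁₂ * P ≤ N₂ * Q)
    (c₁ : f₀₂₃ * P + f₁ * Q ≤ N₃ * P) (c₂ : f₀₁₃ * P + f₂ * Q ≤ N₃ * P)
    (c₃ : f₀₁₂ * P + f₃ * Q ≤ N₃ * P) (d : f₁₂₃ ≤ N₃)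
    (h₁ : N₂ + 3 * N₃ + e < f₁ + f₀₁ + f₁₂ + f₁₃ + f₀₁₂ + f₀₁₃ + f₁₂₃ + e)
    (h₂ : N₂ + 3 * N₃ + e < f₂ + f₀₂ + f₁₂ + f₂₃ + f₀₁₂ + f₀₂₃ + f₁₂₃ + e)
    (h₃ : N₂ + 3 * N₃ + e < f₃ + f₀₃ + f₁₃ + f₂₃ + f₀₁₃ + f₀₂₃ + f₁₂₃ + e) : False := by
  -- With `r = P - 2Q`, the sum of `r·aᵢ`, `2·bᵢ`, `2·cᵢ` over all `i` and of `3P·d` bounds exactly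
  -- `P` times the right side of `hsum` by `P(3N₂ + 9N₃)`.
  obtain ⟨r, rfl⟩ := Nat.exists_eq_add_of_le hPQ
  have u₁ := Nat.mul_le_mul_left r a₁
  have u₂ := Nat.mul_le_mul_left r a₂
  have u₃ := Nat.mul_le_mul_left r a₃
  have v := Nat.mul_le_mul_left (2 * Q + r) d
  have hsum : 3 * N₂ + 9 * N₃ < f₁ + f₂ + f₃ + f₀₁ + f₀₂ + f₀₃ + 2 * (f₁₂ + f₁₃ + f₂₃)
      + 2 * (f₀₁₂ + f₀₁₃ + f₀₂₃) + 3 * f₁₂₃ := by omega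
  have w := Nat.mul_lt_mul_of_pos_left hsum hP
  ring_nf at *
  linarith

/-- The arithmetic of the case that most members of the family contain at least two of the vertices
`1`, `2`, `3`. -/
theorem triangle_arith {N₂ N₃ P Q R f₀ f₁ f₂ f₃ f₀₁ f₀₂ f₀₃ f₁₂ f₁₃ f₂₃ f₀₁₂ f₀₁₃ f₀₂₃ f₁₂₃ e : ℕ}
    (hPQ : 5 * Q ≤ P) (hRQ : R ≤ Q) (hR : 2 * Q ≤ 3 * R) (hN : N₂ = P + Q)
    (p₀ : f₀ ≤ P) (q₁ : f₀₁ ≤ Q) (q₂ : f₀₂ ≤ Q) (q₃ : f₀₃ ≤ Q)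
    (a₁ : R ≤ f₀ → f₂₃ ≤ Q + R) (a₂ : R ≤ f₀ → f₁₃ ≤ Q + R) (a₃ : R ≤ f₀ → f₁₂ ≤ Q + R)
    (b₁ : R ≤ f₁ → f₀₂₃ + R ≤ N₃) (b₂ : R ≤ f₂ → f₀₁₃ + R ≤ N₃) (b₃ : R ≤ f₃ → f₀₁₂ + R ≤ N₃)
    (d₁ : f₀₁₂ ≤ N₃) (d₂ : f₀₁₃ ≤ N₃) (d₃ : f₀₂₃ ≤ N₃) (d : f₁₂₃ ≤ N₃)
    (h₀ : N₂ + 3 * N₃ + e < f₀ + f₀₁ + f₀₂ + f₀₃ + f₀₁₂ + f₀₁₃ + f₀₂₃ + e)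
    (h₁ : N₂ + 3 * N₃ + e < f₁ + f₀₁ + f₁₂ + f₁₃ + f₀₁₂ + f₀₁₃ + f₁₂₃ + e)
    (h₂ : N₂ + 3 * N₃ + e < f₂ + f₀₂ + f₁₂ + f₂₃ + f₀₁₂ + f₀₂₃ + f₁₂₃ + e)
    (h₃ : N₂ + 3 * N₃ + e < f₃ + f₀₃ + f₁₃ + f₂₃ + f₀₁₃ + f₀₂₃ + f₁₂₃ + e) : False := by
  -- `h₀` with `N₂ = P + Q` gives `f₀ > P - 2Q ≥ 3Q ≥ R`.
  have r₀ : R ≤ f₀ := by omega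
  have a₁ := a₁ r₀
  have a₂ := a₂ r₀
  have a₃ := a₃ r₀
  -- Now `h₁` gives `f₁ > P - 2Q - 2R ≥ 3Q - 2R ≥ R`; likewise for `f₂` and `f₃`.
  have b₁ := b₁ (by omega)
  have b₂ := b₂ (by omega)
  have b₃ := b₃ (by omega)
  -- Each of the three triples through 0 loses `R`, so `h₀` would force `3R < 2Q`.
  omega

theorem five_mul_choose_le {n k : ℕ} (hk : 3 ≤ k) (hn : 6 * k ≤ n) :
    5 * (n - 5).choose (k - 3) ≤ (n - 5).choose (k - 2) := by
  have h := Nat.choose_succ_right_eq (n - 5) (k - 3)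
  rw [show k - 3 + 1 = k - 2 by omega] at h
  refine Nat.le_of_mul_le_mul_right ?_ (show 0 < k - 2 by omega)
  rw [h, mul_comm 5, mul_assoc]
  exact Nat.mul_le_mul_left _ (by omega)

theorem two_mul_choose_le {n k : ℕ} (hk : 3 ≤ k) (hn : 6 * k ≤ n) :
    2 * (n - 5).choose (k - 3) ≤ 3 * (n - 6).choose (k - 3) := by
  have h := Nat.choose_mul_succ_eq (n - 6) (k - 3)
  rw [show n - 6 + 1 = n - 5 by omega] at h
  refine Nat.le_of_mul_le_mul_right ?_ (show 0 < n - 5 by omega)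
  rw [mul_assoc 3, h, ← mul_assoc, mul_comm 2, mul_comm 3, mul_assoc, mul_assoc]
  exact Nat.mul_le_mul_left _ (by omega)

open Finset

/-! ### The upper bound -/

section UpperBound

variable {n k : ℕ} {F : Finset (Finset (Fin n))} {x : Fin 4 → Fin n}

/-- By Pascal's rule the two sides differ only in the trace of all four vertices, against its
maximal size `C(n-4, k-4)`. This trace contributes to all four degrees and cancels in the
arithmetic. -/
theorem add_card_traceFamily_le (hk : 3 ≤ k) (hn : 6 * k ≤ n)
    (hF : (F : Set (Finset (Fin n))).Sized k) (hx : Function.Injective x) :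
    (n - 4).choose (k - 2) + 3 * (n - 4).choose (k - 3) + (traceFamily F x {0, 1, 2, 3}).card
      ≤ (n - 2).choose (k - 2) + (n - 4).choose (k - 3) := by
  have hT : (traceFamily F x {0, 1, 2, 3}).card + (n - 4).choose (k - 3)
      ≤ (n - 3).choose (k - 3) := by
    -- For `k = 3` the truncated `k - 4` would allow one set, whereas this trace is empty.
    obtain rfl | hk' := hk.eq_or_lt
    · rw [traceFamily_eq_empty hF hx (by decide)]
      simp
    · have h := card_traceFamily_le hF hx {0, 1, 2, 3}
      rw [Fintype.card_fin, show ({0, 1, 2, 3} : Finset (Fin 4)).card = 4 by decide] at h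
      rw [show n - 3 = n - 4 + 1 by omega, show k - 3 = k - 4 + 1 by omega, Nat.choose_succ_succ']
      omega
  rw [show n - 2 = n - 4 + 1 + 1 by omega, show k - 2 = k - 3 + 1 by omega,
    Nat.choose_succ_succ', Nat.choose_succ_succ' (n - 4), show n - 4 + 1 = n - 3 by omega]
  omega

theorem card_univ_sdiff_image (hx : Function.Injective x) :
    (univ \ univ.image x).card = n - 4 := by
  rw [card_sdiff_of_subset (subset_univ _), card_image_of_injective _ hx, card_univ, card_univ,
    Fintype.card_fin, Fintype.card_fin]

theorem trace_le_of_le_trace (hn : 6 * k ≤ n) (hF : (F : Set (Finset (Fin n))).Sized k)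
    (hI : (F : Set (Finset (Fin n))).Intersecting) (hx : Function.Injective x)
    {S T : Finset (Fin 4)} (hST : Disjoint S T) {j : ℕ} (hj : j + S.card ≤ k)
    (h : (n - 4 - j).choose (k - S.card - j) ≤ (traceFamily F x S).card) :
    (traceFamily F x T).card + (n - 4 - j).choose (k - T.card) ≤ (n - 4).choose (k - T.card) :=
  cross_intersecting_of_le_card (card_univ_sdiff_image hx)
    (traceFamily_subset_powersetCard hF hx S) (traceFamily_subset_powersetCard hF hx T)
    (traceFamily_cross_intersecting hI hST) (by omega) (by omega) h

theorem trace_mul_le_of_trace_le (hn : 6 * k ≤ n) (hF : (F : Set (Finset (Fin n))).Sized k)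
    (hI : (F : Set (Finset (Fin n))).Intersecting) (hx : Function.Injective x)
    {S T : Finset (Fin 4)} (hST : Disjoint S T) (hS : S.card < k)
    (h : (traceFamily F x S).card ≤ (n - 5).choose (k - S.card - 1)) :
    (traceFamily F x T).card * (n - 5).choose (k - S.card - 1)
      + (traceFamily F x S).card * (n - 5).choose (k - T.card)
      ≤ (n - 4).choose (k - T.card) * (n - 5).choose (k - S.card - 1) :=
  cross_intersecting_of_card_le (card_univ_sdiff_image hx)
    (traceFamily_subset_powersetCard hF hx S) (traceFamily_subset_powersetCard hF hx T)
    (traceFamily_cross_intersecting hI hST) (by omega) (by omega) h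

theorem exists_vertexDegree_le_of_star (hk : 3 ≤ k) (hn : 6 * k ≤ n)
    (hF : (F : Set (Finset (Fin n))).Sized k) (hI : (F : Set (Finset (Fin n))).Intersecting)
    (hx : Function.Injective x)
    (h1 : ∀ S, 0 ∉ S → S.card = 1 → (traceFamily F x S).card ≤ (n - 5).choose (k - 2))
    (h2 : ∀ S, 0 ∉ S → S.card = 2 → (traceFamily F x S).card ≤ (n - 5).choose (k - 3)) :
    ∃ i, vertexDegree F (x i) ≤ (n - 2).choose (k - 2) + (n - 4).choose (k - 3) := by
  have hT := add_card_traceFamily_le hk hn hF hx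
  have hPQ := five_mul_choose_le hk hn
  have hP : 0 < (n - 5).choose (k - 2) := Nat.choose_pos (by omega)
  have h12 : ∀ S T : Finset (Fin 4), 0 ∉ S → S.card = 1 → T.card = 2 → Disjoint S T →
      (traceFamily F x T).card + (traceFamily F x S).card ≤ (n - 4).choose (k - 2) := by
    intro S T h0 hS hT hST
    have := trace_mul_le_of_trace_le hn hF hI hx hST (by omega)
      (by rw [hS]; exact h1 S h0 hS)
    rw [hS, hT, show k - 1 - 1 = k - 2 by omega, ← add_mul] at this
    -- For a singleton against a pair both weights equal `C(n-5, k-2)`, so the trade-off is one for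
    -- one.
    exact Nat.le_of_mul_le_mul_right this hP
  have h22 : ∀ S T : Finset (Fin 4), 0 ∉ S → S.card = 2 → T.card = 2 → Disjoint S T →
      (traceFamily F x T).card * (n - 5).choose (k - 3)
      + (traceFamily F x S).card * (n - 5).choose (k - 2)
      ≤ (n - 4).choose (k - 2) * (n - 5).choose (k - 3) := by
    intro S T h0 hS hT hST
    have := trace_mul_le_of_trace_le hn hF hI hx hST (by omega)
      (by rw [hS]; exact h2 S h0 hS)
    rwa [hS, hT, show k - 2 - 1 = k - 3 by omega] at this
  have h13 : ∀ S T : Finset (Fin 4), 0 ∉ S → S.card = 1 → T.card = 3 → Disjoint S T →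
      (traceFamily F x T).card * (n - 5).choose (k - 2)
      + (traceFamily F x S).card * (n - 5).choose (k - 3)
      ≤ (n - 4).choose (k - 3) * (n - 5).choose (k - 2) := by
    intro S T h0 hS hT hST
    have := trace_mul_le_of_trace_le hn hF hI hx hST (by omega)
      (by rw [hS]; exact h1 S h0 hS)
    rwa [hS, hT, show k - 1 - 1 = k - 2 by omega] at this
  have h3 : (traceFamily F x {1, 2, 3}).card ≤ (n - 4).choose (k - 3) :=
    card_traceFamily_le hF hx {1, 2, 3}
  obtain ⟨-, e1, e2, e3⟩ := vertexDegree_eq_of_four F x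
  by_contra! hd
  have d1 := hT.trans_lt (hd 1)
  have d2 := hT.trans_lt (hd 2)
  have d3 := hT.trans_lt (hd 3)
  rw [e1] at d1
  rw [e2] at d2
  rw [e3] at d3
  exact star_arith hP (by omega)
    (h12 {3} {0, 1} (by decide) rfl rfl (by decide)) (h12 {1} {0, 2} (by decide) rfl rfl (by decide))
    (h12 {2} {0, 3} (by decide) rfl rfl (by decide))
    (h22 {2, 3} {0, 1} (by decide) rfl rfl (by decide))
    (h22 {1, 3} {0, 2} (by decide) rfl rfl (by decide))
    (h22 {1, 2} {0, 3} (by decide) rfl rfl (by decide))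
    (h13 {1} {0, 2, 3} (by decide) rfl rfl (by decide))
    (h13 {2} {0, 1, 3} (by decide) rfl rfl (by decide))
    (h13 {3} {0, 1, 2} (by decide) rfl rfl (by decide)) h3 d1 d2 d3

theorem exists_vertexDegree_le_of_triangle (hk : 3 ≤ k) (hn : 6 * k ≤ n)
    (hF : (F : Set (Finset (Fin n))).Sized k) (hI : (F : Set (Finset (Fin n))).Intersecting)
    (hx : Function.Injective x)
    (h1 : ∀ S, S.card = 1 → (traceFamily F x S).card ≤ (n - 5).choose (k - 2))
    (h2 : ∀ S, 0 ∈ S → S.card = 2 → (traceFamily F x S).card ≤ (n - 5).choose (k - 3)) :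
    ∃ i, vertexDegree F (x i) ≤ (n - 2).choose (k - 2) + (n - 4).choose (k - 3) := by
  have hT := add_card_traceFamily_le hk hn hF hx
  have hN : (n - 4).choose (k - 2) = (n - 5).choose (k - 2) + (n - 5).choose (k - 3) := by
    rw [show n - 4 = n - 5 + 1 by omega, show k - 2 = k - 3 + 1 by omega, Nat.choose_succ_succ',
      add_comm]
  have hP : (n - 5).choose (k - 2) = (n - 6).choose (k - 2) + (n - 6).choose (k - 3) := by
    rw [show n - 5 = n - 6 + 1 by omega, show k - 2 = k - 3 + 1 by omega, Nat.choose_succ_succ',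
      add_comm]
  have h12 : ∀ S T : Finset (Fin 4), S.card = 1 → T.card = 2 → Disjoint S T →
      (n - 6).choose (k - 3) ≤ (traceFamily F x S).card →
      (traceFamily F x T).card ≤ (n - 5).choose (k - 3) + (n - 6).choose (k - 3) := by
    intro S T hS hT hST h
    have := trace_le_of_le_trace hn hF hI hx hST (j := 2) (by omega)
      (by rwa [hS, show k - 1 - 2 = k - 3 by omega, Nat.sub_sub])
    rw [hT, Nat.sub_sub, show 4 + 2 = 6 from rfl] at this
    omega
  have h13 : ∀ S T : Finset (Fin 4), S.card = 1 → T.card = 3 → Disjoint S T →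
      (n - 6).choose (k - 3) ≤ (traceFamily F x S).card →
      (traceFamily F x T).card + (n - 6).choose (k - 3) ≤ (n - 4).choose (k - 3) := by
    intro S T hS hT hST h
    have := trace_le_of_le_trace hn hF hI hx hST (j := 2) (by omega)
      (by rwa [hS, show k - 1 - 2 = k - 3 by omega, Nat.sub_sub])
    rwa [hT, Nat.sub_sub] at this
  have h3 : ∀ T : Finset (Fin 4), T.card = 3 →
      (traceFamily F x T).card ≤ (n - 4).choose (k - 3) := by
    intro T hT
    rw [← hT]
    exact card_traceFamily_le hF hx T
  obtain ⟨e0, e1, e2, e3⟩ := vertexDegree_eq_of_four F x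
  by_contra! hd
  have d0 := hT.trans_lt (hd 0)
  have d1 := hT.trans_lt (hd 1)
  have d2 := hT.trans_lt (hd 2)
  have d3 := hT.trans_lt (hd 3)
  rw [e0] at d0
  rw [e1] at d1
  rw [e2] at d2
  rw [e3] at d3
  exact triangle_arith (five_mul_choose_le hk hn) (Nat.choose_le_choose _ (by omega))
    (two_mul_choose_le hk hn) hN (h1 {0} rfl)
    (h2 {0, 1} (by decide) rfl) (h2 {0, 2} (by decide) rfl) (h2 {0, 3} (by decide) rfl)
    (h12 {0} {2, 3} rfl rfl (by decide)) (h12 {0} {1, 3} rfl rfl (by decide))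
    (h12 {0} {1, 2} rfl rfl (by decide)) (h13 {1} {0, 2, 3} rfl rfl (by decide))
    (h13 {2} {0, 1, 3} rfl rfl (by decide)) (h13 {3} {0, 1, 2} rfl rfl (by decide))
    (h3 _ rfl) (h3 _ rfl) (h3 _ rfl) (h3 _ rfl) d0 d1 d2 d3

/-- The case distinction for the pairs: of any two complementary pairs one has property `p`. -/
theorem exists_forall_pair {p : Finset (Fin 4) → Prop}
    (hp : ∀ S T : Finset (Fin 4), S.card = 2 → T.card = 2 → Disjoint S T → p S ∨ p T) :
    (∃ c, ∀ S, c ∉ S → S.card = 2 → p S) ∨ ∃ c, ∀ S, c ∈ S → S.card = 2 → p S := by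
  have hs0 : ∀ S : Finset (Fin 4), 0 ∉ S → S.card = 2 → S = {1, 2} ∨ S = {1, 3} ∨ S = {2, 3} := by
    decide
  have hs1 : ∀ S : Finset (Fin 4), 1 ∉ S → S.card = 2 → S = {0, 2} ∨ S = {0, 3} ∨ S = {2, 3} := by
    decide
  have hs2 : ∀ S : Finset (Fin 4), 2 ∉ S → S.card = 2 → S = {0, 1} ∨ S = {0, 3} ∨ S = {1, 3} := by
    decide
  have hs3 : ∀ S : Finset (Fin 4), 3 ∉ S → S.card = 2 → S = {0, 1} ∨ S = {0, 2} ∨ S = {1, 2} := by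
    decide
  have ht0 : ∀ S : Finset (Fin 4), 0 ∈ S → S.card = 2 → S = {0, 1} ∨ S = {0, 2} ∨ S = {0, 3} := by
    decide
  have ht1 : ∀ S : Finset (Fin 4), 1 ∈ S → S.card = 2 → S = {0, 1} ∨ S = {1, 2} ∨ S = {1, 3} := by
    decide
  have ht2 : ∀ S : Finset (Fin 4), 2 ∈ S → S.card = 2 → S = {0, 2} ∨ S = {1, 2} ∨ S = {2, 3} := by
    decide
  have ht3 : ∀ S : Finset (Fin 4), 3 ∈ S → S.card = 2 → S = {0, 3} ∨ S = {1, 3} ∨ S = {2, 3} := by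
    decide
  -- One edge from each of the three perfect matchings of `K₄`: the eight choices are the four stars
  -- and the four triangles.
  rcases hp {0, 1} {2, 3} rfl rfl (by decide) with h | h <;>
  rcases hp {0, 2} {1, 3} rfl rfl (by decide) with h' | h' <;>
  rcases hp {0, 3} {1, 2} rfl rfl (by decide) with h'' | h''
  · right; use 0; intro S a b; rcases ht0 S a b with rfl | rfl | rfl <;> assumption
  · left; use 3; intro S a b; rcases hs3 S a b with rfl | rfl | rfl <;> assumption
  · left; use 2; intro S a b; rcases hs2 S a b with rfl | rfl | rfl <;> assumption
  · right; use 1; intro S a b; rcases ht1 S a b with rfl | rfl | rfl <;> assumption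
  · left; use 1; intro S a b; rcases hs1 S a b with rfl | rfl | rfl <;> assumption
  · right; use 2; intro S a b; rcases ht2 S a b with rfl | rfl | rfl <;> assumption
  · right; use 3; intro S a b; rcases ht3 S a b with rfl | rfl | rfl <;> assumption
  · left; use 0; intro S a b; rcases hs0 S a b with rfl | rfl | rfl <;> assumption

theorem exists_vertexDegree_le (hk : 3 ≤ k) (hn : 6 * k ≤ n)
    (hF : (F : Set (Finset (Fin n))).Sized k) (hI : (F : Set (Finset (Fin n))).Intersecting)
    (hx : Function.Injective x) :
    ∃ i, vertexDegree F (x i) ≤ (n - 2).choose (k - 2) + (n - 4).choose (k - 3) := by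
  have hstar : ∀ c, (∀ S, c ∉ S → S.card = 1 → (traceFamily F x S).card ≤ (n - 5).choose (k - 2)) →
      (∀ S, c ∉ S → S.card = 2 → (traceFamily F x S).card ≤ (n - 5).choose (k - 3)) →
      ∃ i, vertexDegree F (x i) ≤ (n - 2).choose (k - 2) + (n - 4).choose (k - 3) := by
    intro c h1 h2
    obtain ⟨i, hi⟩ := exists_vertexDegree_le_of_star (x := x ∘ Equiv.swap 0 c) hk hn hF hI
      (hx.comp (Equiv.injective _))
      (fun S h0 hS => by
        rw [traceFamily_comp]
        exact h1 _ (by simpa [mem_map_equiv] using h0) (by rw [card_map, hS]))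
      (fun S h0 hS => by
        rw [traceFamily_comp]
        exact h2 _ (by simpa [mem_map_equiv] using h0) (by rw [card_map, hS]))
    exact ⟨_, hi⟩
  have htriangle : (∀ S, S.card = 1 → (traceFamily F x S).card ≤ (n - 5).choose (k - 2)) →
      ∀ c, (∀ S, c ∈ S → S.card = 2 → (traceFamily F x S).card ≤ (n - 5).choose (k - 3)) →
      ∃ i, vertexDegree F (x i) ≤ (n - 2).choose (k - 2) + (n - 4).choose (k - 3) := by
    intro h1 c h2
    obtain ⟨i, hi⟩ := exists_vertexDegree_le_of_triangle (x := x ∘ Equiv.swap 0 c) hk hn hF hI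
      (hx.comp (Equiv.injective _))
      (fun S hS => by
        rw [traceFamily_comp]
        exact h1 _ (by rw [card_map, hS]))
      (fun S h0 hS => by
        rw [traceFamily_comp]
        exact h2 _ (by simpa [mem_map_equiv] using h0) (by rw [card_map, hS]))
    exact ⟨_, hi⟩
  -- A trace of at least star size forces every disjoint one to at most star size: `j = 1` leaves
  -- `C(n-4, b) - C(n-5, b) = C(n-5, b-1)`.
  have hsmall : ∀ S T : Finset (Fin 4), Disjoint S T → S.card + 1 ≤ k → T.card + 1 ≤ k →
      (n - 5).choose (k - S.card - 1) ≤ (traceFamily F x S).card →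
      (traceFamily F x T).card ≤ (n - 5).choose (k - T.card - 1) := by
    intro S T hST hS hT h
    have := trace_le_of_le_trace hn hF hI hx hST (j := 1) (by omega) (by rwa [Nat.sub_sub])
    have h' : (n - 4).choose (k - T.card)
        = (n - 5).choose (k - T.card - 1) + (n - 5).choose (k - T.card) := by
      rw [show n - 4 = n - 5 + 1 by omega, show k - T.card = k - T.card - 1 + 1 by omega,
        Nat.choose_succ_succ', Nat.add_sub_cancel]
    rw [Nat.sub_sub n 4 1, show 4 + 1 = 5 from rfl] at this
    omega
  by_cases h1 : ∀ S : Finset (Fin 4), S.card = 1 →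
      (traceFamily F x S).card ≤ (n - 5).choose (k - 2)
  · have hpair := exists_forall_pair
      (p := fun S => (traceFamily F x S).card ≤ (n - 5).choose (k - 3)) (fun S T hS hT hST => by
        by_cases h : (traceFamily F x S).card ≤ (n - 5).choose (k - 3)
        · exact Or.inl h
        · have := hsmall S T hST (by omega) (by omega)
            (by rw [hS, show k - 2 - 1 = k - 3 by omega]; omega)
          rw [hT, show k - 2 - 1 = k - 3 by omega] at this
          exact Or.inr this)
    rcases hpair with ⟨c, hc⟩ | ⟨c, hc⟩
    · exact hstar c (fun S _ => h1 S) hc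
    · exact htriangle h1 c hc
  · push Not at h1
    obtain ⟨S, hS, h⟩ := h1
    obtain ⟨c, rfl⟩ := card_eq_one.1 hS
    -- The large trace of `{c}` makes all singletons and pairs avoiding `c` small.
    have key := fun T (hc : c ∉ T) (hT : T.card + 1 ≤ k) =>
      hsmall {c} T (disjoint_singleton_left.2 hc) (by omega) hT
        (by rw [hS, show k - 1 - 1 = k - 2 by omega]; exact h.le)
    refine hstar c (fun T hc hT => ?_) (fun T hc hT => ?_)
    · have := key T hc (by omega)
      rwa [hT, show k - 1 - 1 = k - 2 by omega] at this
    · have := key T hc (by omega)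
      rwa [hT, show k - 2 - 1 = k - 3 by omega] at this

end UpperBound

theorem largestDegree_four_le {n k : ℕ} (hk : 3 ≤ k) (hn : 6 * k ≤ n)
    {F : Finset (Finset (Fin n))} (hF : (F : Set (Finset (Fin n))).Sized k)
    (hI : (F : Set (Finset (Fin n))).Intersecting) :
    largestDegree F 4 ≤ (n - 2).choose (k - 2) + (n - 4).choose (k - 3) := by
  have h4 : 4 ≤ n := by omega
  obtain ⟨i, hi⟩ := exists_vertexDegree_le hk hn hF hI
    (x := fun i => degreeOrder F (Fin.castLE h4 i))
    ((degreeOrder F).injective.comp (Fin.castLE_injective h4))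
  refine le_trans ?_ hi
  rw [largestDegree, dif_pos ⟨by omega, h4⟩]
  -- Position 3, counted from 0, carries `d_4`, the least degree among the first four positions.
  refine antitone_degreeOrder F ?_
  rw [Fin.le_def]
  exact Nat.lt_succ_iff.1 i.isLt

/-! ### The extremal family -/

theorem le_largestDegree {n : ℕ} {F : Finset (Finset (Fin n))} {i d : ℕ} (hi : 1 ≤ i)
    {s : Finset (Fin n)} (hs : s.card = i) (h : ∀ x ∈ s, d ≤ vertexDegree F x) :
    d ≤ largestDegree F i := by
  have hin : i ≤ n := by simpa [hs] using card_le_univ s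
  rw [largestDegree, dif_pos ⟨hi, hin⟩]
  -- Pigeonhole: `i` vertices do not fit into the first `i - 1` positions.
  obtain ⟨x, hx, hle⟩ : ∃ x ∈ s, i - 1 ≤ ((degreeOrder F).symm x).val := by
    by_contra! hlt
    have := card_le_card_of_injOn (t := range (i - 1)) (fun x => ((degreeOrder F).symm x).val)
      (fun x hx => by simpa using hlt x hx)
      (fun x _ y _ hxy => (degreeOrder F).symm.injective (Fin.ext hxy))
    rw [card_range] at this
    omega
  have := antitone_degreeOrder F (show (⟨i - 1, by omega⟩ : Fin n) ≤ (degreeOrder F).symm x from hle)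
  simp only [Equiv.apply_symm_apply] at this
  exact (h x hx).trans this

theorem sized_familyH (n k l : ℕ) : (familyH n k l : Set (Finset (Fin n))).Sized k :=
  fun _ hA => (mem_powersetCard.1 (mem_filter.1 (mem_coe.1 hA)).1).2

theorem intersecting_familyH {n k l : ℕ} (hl : 1 ≤ l) (hn : l < n) :
    (familyH n k l : Set (Finset (Fin n))).Intersecting := by
  intro A hA B hB hAB
  rw [disjoint_left] at hAB
  rcases (mem_filter.1 (mem_coe.1 hA)).2 with ⟨⟨a, haA, ha⟩, a', haA', ha'⟩ | hA' <;>
  rcases (mem_filter.1 (mem_coe.1 hB)).2 with ⟨⟨b, hbB, hb⟩, b', hbB', hb'⟩ | hB'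
  · exact hAB haA (Fin.ext (ha.trans hb.symm) ▸ hbB)
  · exact hAB haA' (hB' a' ha')
  · exact hAB (hA' b' hb') hbB'
  · have h1 : 1 ≤ (⟨1, by omega⟩ : Fin n).val ∧ (⟨1, by omega⟩ : Fin n).val ≤ l := ⟨le_rfl, hl⟩
    exact hAB (hA' _ h1) (hB' _ h1)

/-- A lower bound for the degree of `a` in a family that contains all `k`-sets which contain `a` and
`b`, and all those which contain `s ∋ a` but not `b`. -/
theorem choose_add_choose_le_vertexDegree {n k : ℕ} (hk : 3 ≤ k) {F : Finset (Finset (Fin n))}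
    {a b : Fin n} {s : Finset (Fin n)} (hab : a ≠ b) (has : a ∈ s) (hbs : b ∉ s)
    (hs : s.card = 3) (h1 : ∀ A ∈ powersetCard k univ, a ∈ A → b ∈ A → A ∈ F)
    (h2 : ∀ A ∈ powersetCard k univ, s ⊆ A → b ∉ A → A ∈ F) :
    (n - 2).choose (k - 2) + (n - 4).choose (k - 3) ≤ vertexDegree F a := by
  have c1 := card_filter_subset_disjoint (X := univ) (S := {a, b}) (R := ∅) (r := k)
    (subset_univ _) (subset_univ _) (disjoint_empty_right _) (by rw [card_pair hab]; omega)
  have c2 := card_filter_subset_disjoint (X := univ) (S := s) (R := {b}) (r := k)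
    (subset_univ _) (subset_univ _) (disjoint_singleton_right.2 hbs) (by omega)
  rw [card_pair hab, card_empty, Nat.sub_zero, card_univ, Fintype.card_fin] at c1
  rw [hs, card_singleton, Nat.sub_sub, card_univ, Fintype.card_fin] at c2
  rw [← c1, ← c2, vertexDegree, ← card_union_of_disjoint]
  · refine card_le_card fun A hA => ?_
    rw [mem_union, mem_filter, mem_filter] at hA
    rcases hA with ⟨hA, hS, -⟩ | ⟨hA, hS, hb⟩
    · have haA := hS (mem_insert_self a _)
      exact mem_filter.2 ⟨h1 A hA haA (hS (by simp)), haA⟩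
    · exact mem_filter.2 ⟨h2 A hA hS (disjoint_singleton_right.1 hb), hS has⟩
  · refine disjoint_left.2 fun A hA hA' => ?_
    exact disjoint_singleton_right.1 (mem_filter.1 hA').2.2 ((mem_filter.1 hA).2.1 (by simp))

theorem le_largestDegree_familyH {n k : ℕ} (hk : 3 ≤ k) (hn : 4 ≤ n) :
    (n - 2).choose (k - 2) + (n - 4).choose (k - 3) ≤ largestDegree (familyH n k 3) 4 := by
  have hv : ∀ i : Fin 4, (Fin.castLE hn i).val = i.val := fun _ => rfl
  have hinj := Fin.castLE_injective hn
  have hmem : ∀ x : Fin n, 1 ≤ x.val ∧ x.val ≤ 3 → x ∈ ({1, 2, 3} : Finset (Fin 4)).image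
      (Fin.castLE hn) := by
    intro x hx
    refine mem_image.2 ⟨⟨x.val, by omega⟩, ?_, Fin.ext rfl⟩
    simp only [mem_insert, mem_singleton, Fin.ext_iff]
    change x.val = 1 ∨ x.val = 2 ∨ x.val = 3
    omega
  refine le_largestDegree (by omega) (s := univ.image (Fin.castLE hn))
    (by rw [card_image_of_injective _ hinj, card_univ, Fintype.card_fin]) ?_
  intro x hx
  obtain ⟨i, -, rfl⟩ := mem_image.1 hx
  by_cases hi : i = 0
  · subst hi
    -- Any sets through 0 that meet `{1, 2, 3}` serve here: those containing 1, and those containing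
    -- 2 and 3 but not 1.
    refine choose_add_choose_le_vertexDegree hk (b := Fin.castLE hn 1)
      (s := ({0, 2, 3} : Finset (Fin 4)).image (Fin.castLE hn)) (hinj.ne (by decide))
      (mem_image_of_mem _ (by decide)) (by rw [hinj.mem_finset_image]; decide)
      (by rw [card_image_of_injective _ hinj]; rfl) ?_ ?_
    · intro A hA h0 h1
      exact mem_filter.2 ⟨hA, Or.inl ⟨⟨_, h0, rfl⟩, _, h1, by rw [hv]; decide⟩⟩
    · intro A hA hs _
      exact mem_filter.2 ⟨hA, Or.inl ⟨⟨_, hs (mem_image_of_mem _ (show 0 ∈ _ by decide)), rfl⟩, _,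
        hs (mem_image_of_mem _ (show 2 ∈ _ by decide)), by rw [hv]; decide⟩⟩
  · have hi' : 1 ≤ i.val ∧ i.val ≤ 3 := by
      have : i.val ≠ 0 := fun h => hi (Fin.ext h)
      omega
    refine choose_add_choose_le_vertexDegree hk (b := Fin.castLE hn 0)
      (s := ({1, 2, 3} : Finset (Fin 4)).image (Fin.castLE hn)) (hinj.ne hi)
      (hmem _ hi') (by rw [hinj.mem_finset_image]; decide)
      (by rw [card_image_of_injective _ hinj]; rfl) ?_ ?_
    · intro A hA ha h0
      exact mem_filter.2 ⟨hA, Or.inl ⟨⟨_, h0, rfl⟩, _, ha, hi'⟩⟩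
    · intro A hA hs _
      exact mem_filter.2 ⟨hA, Or.inr fun x hx => hs (hmem x hx)⟩

theorem theorem1p8 (n k : ℕ) (hk : 3 ≤ k) (hn : 6 * k ≤ n) :
    (∀ F : Finset (Finset (Fin n)),
      (F : Set (Finset (Fin n))).Sized k →
      (F : Set (Finset (Fin n))).Intersecting →
      largestDegree F 4 ≤ (n - 2).choose (k - 2) + (n - 4).choose (k - 3)) ∧
    ((familyH n k 3 : Set (Finset (Fin n))).Sized k ∧
      (familyH n k 3 : Set (Finset (Fin n))).Intersecting ∧
      largestDegree (familyH n k 3) 4 = (n - 2).choose (k - 2) + (n - 4).choose (k - 3)) := by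
  have hI : (familyH n k 3 : Set (Finset (Fin n))).Intersecting :=
    intersecting_familyH (by omega) (by omega)
  exact ⟨fun F hF hFI => largestDegree_four_le hk hn hF hFI, sized_familyH n k 3, hI,
    (largestDegree_four_le hk hn (sized_familyH n k 3) hI).antisymm
      (le_largestDegree_familyH hk (by omega))⟩
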